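/- **Setting.** Let $c,L,T>0$ and let $0=x_0<x_1<\dots<x_N=L$ ($N\ge 1$) split $(0,L)$ into the subdomains $\Omega_i=(x_{i-1},x_i)$, $1\le i\le N$, with widths $h_i=x_i-x_{i-1}$ and $h_{\min}=\min_{1\le i\le N}h_i$. Let $\theta\in(0,1]$. The Neumann–Neumann waveform relaxation (NNWR) iteration for the error equations of the wave equation with constant speed $c$, on the time window $(0,T)$, starts from initial guesses $w_i^0\in L^1(0,T)$, $1\le i\le N-1$, at the interfaces $x_i$; put $w_0^k=w_N^k=0$ for all $k\ge 0$. For $k=1,2,\dots$ one solves, for $1\le i\le N$, $$\partial_{tt}u_i^k-c^2\partial_{xx}u_i^k=0\ \text{ in }\Omega_i\times(0,T),\qquad u_i^k(\cdot,0)=\partial_tu_i^k(\cdot,0)=0,\qquad u_i^k(x_{i-1},t)=w_{i-1}^{k-1}(t),\quad u_i^k(x_i,t)=w_i^{k-1}(t),$$ then $$\partial_{tt}\varphi_i^k-c^2\partial_{xx}\varphi_i^k=0\ \text{ in }\Omega_i\times(0,T),\qquad \varphi_i^k(\cdot,0)=\partial_t\varphi_i^k(\cdot,0)=0,$$ $$-\partial_x\varphi_i^k(x_{i-1},t)=(\partial_xu_{i-1}^k-\partial_xu_i^k)(x_{i-1},t)\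 \ (i\ge 2),\qquad \partial_x\varphi_i^k(x_i,t)=(\partial_xu_i^k-\partial_xu_{i+1}^k)(x_i,t)\ \ (i\le N-1),$$ $$\varphi_1^k(0,t)=0,\qquad \varphi_N^k(L,t)=0,$$ and sets $$w_i^k(t)=w_i^{k-1}(t)-\theta\bigl(\varphi_i^k(x_i,t)+\varphi_{i+1}^k(x_i,t)\bigr),\qquad 1\le i\le N-1 .$$ Solutions are understood in the weak sense. An integrable function $u$ on $(a,b)\times(0,T)$ solves the wave equation with zero initial data, with Dirichlet traces $u(a,\cdot),u(b,\cdot)\in L^1(0,T)$ and with fluxes $\partial_xu(a,\cdot),\partial_xu(b,\cdot)$ (linear functionals on the smooth functions of $t$ that vanish near $t=T$), if for every smooth $\psi(x,t)$ that vanishes near $t=T$ $$\int_0^T\!\!\int_a^b u\,(\psi_{tt}-c^2\psi_{xx})\,dx\,dt=c^2\Bigl(\langle\partial_xu(b,\cdot),\psi(b,\cdot)\rangle-\langle\partial_xu(a,\cdot),\psi(a,\cdot)\rangle-\int_0^Tu(b,t)\psi_x(b,t)\,dt+\int_0^Tu(a,t)\psi_x(a,t)\,dt\Bigr).$$ **Theorem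 2.1 (Convergence of NNWR for multiple subdomains).** Let $\theta=1/4$ and let $k\ge 1$ be an integer with $T/k\le 2h_{\min}/c$. Then for every run of the NNWR iteration all interface errors vanish after $k$ iterations and the iteration has converged, with zero error in all subdomains, in $k+1$ iterations: $$w_i^k=0\ \text{ a.e. on }(0,T]\quad(1\le i\le N-1),\qquad u_i^{k+1}=0\ \text{ a.e. on }\Omega_i\times(0,T]\quad(1\le i\le N).$$ Here $w_i^k(t)=0$ for every $t\in(0,T]$ if $w_i^k$ is continuous on $(0,T]$, and $u_i^{k+1}=0$ at every point of $[x_{i-1},x_i]\times(0,T]$ if $u_i^{k+1}$ is continuous there. -/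

import Mathlib

open MeasureTheory Set
open scoped ContDiff

namespace NNWR

/-- Test functions of time on `[0, T)`: smooth functions of `t` that vanish near `t = T` and beyond.
They need not vanish at `t = 0`. -/
def timeTest (T : ℝ) : Submodule ℝ (ℝ → ℝ) where
  carrier := {η | ContDiff ℝ ∞ η ∧ ∃ τ < T, ∀ t, τ ≤ t → η t = 0}
  zero_mem' := ⟨contDiff_const, T - 1, by linarith, fun _ _ => rfl⟩
  add_mem' := by
    rintro f g ⟨hf, τ, hτ, hf0⟩ ⟨hg, σ, hσ, hg0⟩
    refine ⟨hf.add hg, max τ σ, max_lt hτ hσ, fun t ht => ?_⟩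
    simp [hf0 t ((le_max_left _ _).trans ht), hg0 t ((le_max_right _ _).trans ht)]
  smul_mem' := by
    rintro r f ⟨hf, τ, hτ, hf0⟩
    refine ⟨contDiff_const.mul hf, τ, hτ, fun t ht => ?_⟩
    simp [hf0 t ht]

/-- Generalised functions of time on `[0, T)`, as functionals on the test functions. A flux
`∂ₓu(x, ·)` is of this kind; the function `g` is the functional `η ↦ ∫₀ᵀ g(t) η(t) dt`. -/
abbrev Flux (T : ℝ) : Type := Module.Dual ℝ (timeTest T)

/-- Space-time test functions `ψ(x, t)`: smooth functions on the plane that vanish near `t = T` and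
beyond. No condition is imposed at `t = 0` or at the ends of the space interval. -/
def IsSpaceTimeTest (T : ℝ) (ψ : ℝ × ℝ → ℝ) : Prop :=
  ContDiff ℝ ∞ ψ ∧ ∃ τ < T, ∀ x t, τ ≤ t → ψ (x, t) = 0

theorem IsSpaceTimeTest.slice_mem {T : ℝ} {ψ : ℝ × ℝ → ℝ} (h : IsSpaceTimeTest T ψ) (x : ℝ) :
    (fun t => ψ (x, t)) ∈ timeTest T := by
  obtain ⟨hψ, τ, hτ, h0⟩ := h
  exact ⟨hψ.comp (contDiff_const.prodMk contDiff_id), τ, hτ, fun t ht => h0 x t ht⟩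

/-- The restriction `t ↦ ψ(x, t)` of a space-time test function to the line at position `x`. -/
def IsSpaceTimeTest.slice {T : ℝ} {ψ : ℝ × ℝ → ℝ} (h : IsSpaceTimeTest T ψ) (x : ℝ) : timeTest T :=
  ⟨fun t => ψ (x, t), h.slice_mem x⟩

/-- Boundary values on `{a} × (0, T)` (left) and `{b} × (0, T)` (right) of a function on
`(a, b) × (0, T)`: its Dirichlet traces `u(a, ·)`, `u(b, ·)` and the traces of its spatial derivative
`∂ₓu(a, ·)`, `∂ₓu(b, ·)` (derivative in the positive `x` direction at both ends). -/
structure Traces (T : ℝ) where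
  dirL : ℝ → ℝ
  dirR : ℝ → ℝ
  dxL : Flux T
  dxR : Flux T

/-- `u` is an integrable weak solution on `(a, b) × (0, T)` of
`∂ₜₜu - c² ∂ₓₓu = 0`, `u(·, 0) = 0`, `∂ₜu(·, 0) = 0`, with boundary values `tr`:
Green's formula (two integrations by parts in `x` and in `t`, where the terms at `t = 0` vanish by the
initial conditions and those at `t = T` vanish because `ψ` does) holds for every test function `ψ`.
Taking `ψ(x, t) = η(t) χ(x)` shows that `u` determines `tr` (the Dirichlet part up to null sets). -/
structure IsWeakSolution (c a b T : ℝ) (u : ℝ × ℝ → ℝ) (tr : Traces T) : Prop where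
  integrable : IntegrableOn u (Ioo a b ×ˢ Ioo 0 T)
  integrable_dirL : IntegrableOn tr.dirL (Ioo 0 T)
  integrable_dirR : IntegrableOn tr.dirR (Ioo 0 T)
  green : ∀ (ψ : ℝ × ℝ → ℝ) (hψ : IsSpaceTimeTest T ψ),
    ∫ p in Ioo a b ×ˢ Ioo 0 T,
        u p * (iteratedDeriv 2 (fun t => ψ (p.1, t)) p.2
          - c ^ 2 * iteratedDeriv 2 (fun x => ψ (x, p.2)) p.1)
      = c ^ 2 * (tr.dxR (hψ.slice b) - tr.dxL (hψ.slice a)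
          - (∫ t in Ioo 0 T, tr.dirR t * deriv (fun x => ψ (x, t)) b)
          + ∫ t in Ioo 0 T, tr.dirL t * deriv (fun x => ψ (x, t)) a)

/-- `0 = x 0 < x 1 < ⋯ < x N = L`. Subdomain number `i` (`0 ≤ i < N`) is `(x i, x (i + 1))`; the
interfaces are the points `x i` with `0 < i < N`. -/
structure IsPartition (N : ℕ) (L : ℝ) (x : ℕ → ℝ) : Prop where
  left : x 0 = 0
  right : x N = L
  lt : ∀ i < N, x i < x (i + 1)

/-- The smallest width of the `N` subdomains (a minimum, since it is used for `N ≥ 1`). -/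
noncomputable def minWidth (N : ℕ) (x : ℕ → ℝ) : ℝ :=
  ⨅ i : Fin N, (x ((i : ℕ) + 1) - x (i : ℕ))

/-- A run of the Neumann-Neumann waveform relaxation iteration for the error equations, on the time
window `(0, T)`, with relaxation parameter `θ`.

* `w k i` is the interface value at `x i` after `k` iterations; `w 0` is the initial guess.
* `u k i` and `φ k i`, for `k ≥ 1` and `i < N`, are the solutions of the Dirichlet step and of the
  Neumann step on `(x i, x (i + 1))` in iteration `k`; `tu k i` and `tφ k i` are their traces.

Equalities between functions of time hold almost everywhere on `(0, T)`. -/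
structure IsRun (N : ℕ) (c T θ : ℝ) (x : ℕ → ℝ) (w : ℕ → ℕ → ℝ → ℝ)
    (u φ : ℕ → ℕ → ℝ × ℝ → ℝ) (tu tφ : ℕ → ℕ → Traces T) : Prop where
  /-- Convention at the physical boundary: `w₀ᵏ = 0`. -/
  w_left : ∀ k, w k 0 =ᵐ[volume.restrict (Ioo 0 T)] 0
  /-- Convention at the physical boundary: `w_Nᵏ = 0`. -/
  w_right : ∀ k, w k N =ᵐ[volume.restrict (Ioo 0 T)] 0
  /-- Dirichlet step: homogeneous wave equation with zero initial data. -/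
  u_wave : ∀ k, ∀ i < N, IsWeakSolution c (x i) (x (i + 1)) T (u (k + 1) i) (tu (k + 1) i)
  /-- Dirichlet step: value at the left end. -/
  u_left : ∀ k, ∀ i < N, (tu (k + 1) i).dirL =ᵐ[volume.restrict (Ioo 0 T)] w k i
  /-- Dirichlet step: value at the right end. -/
  u_right : ∀ k, ∀ i < N, (tu (k + 1) i).dirR =ᵐ[volume.restrict (Ioo 0 T)] w k (i + 1)
  /-- Neumann step: homogeneous wave equation with zero initial data. -/
  φ_wave : ∀ k, ∀ i < N, IsWeakSolution c (x i) (x (i + 1)) T (φ (k + 1) i) (tφ (k + 1) i)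
  /-- Neumann step, first subdomain: homogeneous Dirichlet condition at the physical boundary. -/
  φ_first : ∀ k, (tφ (k + 1) 0).dirL =ᵐ[volume.restrict (Ioo 0 T)] 0
  /-- Neumann step, last subdomain: homogeneous Dirichlet condition at the physical boundary. -/
  φ_last : ∀ k i, i + 1 = N → (tφ (k + 1) i).dirR =ᵐ[volume.restrict (Ioo 0 T)] 0
  /-- Neumann step: condition on the right end of subdomain `i`, which is the interface
  `x (i + 1)`: `∂ₓφ = ∂ₓu(left of it) - ∂ₓu(right of it)`. -/
  φ_right : ∀ k i, i + 1 < N →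
    (tφ (k + 1) i).dxR = (tu (k + 1) i).dxR - (tu (k + 1) (i + 1)).dxL
  /-- Neumann step: condition on the left end of subdomain `i + 1`, which is the interface
  `x (i + 1)`: `-∂ₓφ = ∂ₓu(left of it) - ∂ₓu(right of it)`. -/
  φ_left : ∀ k i, i + 1 < N →
    -(tφ (k + 1) (i + 1)).dxL = (tu (k + 1) i).dxR - (tu (k + 1) (i + 1)).dxL
  /-- Update of the interface value at `x (i + 1)`. -/
  update : ∀ k i, i + 1 < N →
    w (k + 1) (i + 1) =ᵐ[volume.restrict (Ioo 0 T)]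
      fun t => w k (i + 1) t - θ * ((tφ (k + 1) i).dirR t + (tφ (k + 1) (i + 1)).dirL t)

end NNWR

namespace NNWR

/-! ### Generalised functions of time, weak derivatives, delays and the support filtration. -/

section Filtration

variable {T : ℝ}

/-! Boundary data and fluxes are treated as generalised functions of time, filtered by the time
before which they vanish. A Dirichlet trace enters through its weak derivative divided by `c`,
written `W`; a flux is written `P`. On one subdomain the Riemann invariants `P ± W` travel from one
end to the other, which gives `PL + WL = S (PR + WR)` and `PR - WR = S (PL - WL)`, where `S` is the
delay by the crossing time (`IsWeakSolution.delay_eq`, `Transported`).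

Let `m` be the smallest crossing time and let all `W j` vanish before `d`. Two successive delays
gain `2 * m`, so modulo terms vanishing before `d + 2 * m` only expressions of first order in `S`
survive. The flux jump at an interface is then `R j ≡ 2 W j - 2 S W (j-1) - 2 S W (j+1)`, each delay
being that of the subdomain between the two points. The two Neumann traces at that interface are `R
j + 2 S R (j-1)` and `R j + 2 S R (j+1)`. In their sum the first-order terms cancel and exactly `4 W
j` remains, so `θ = 1/4` removes it (`IsRun.step`).

After `k` iterations the data vanish before `2 * k * m ≥ T`, so they are zero. The fluxes of the
next Dirichlet solve then vanish as well, and testing Green's formula against backward solutions of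
the wave equation gives `u = 0` (`IsWeakSolution.ae_eq_zero`). -/

theorem integrable_mul_deriv {w : ℝ → ℝ} (hw : IntegrableOn w (Ioo 0 T)) {η : ℝ → ℝ}
    (hη : ContDiff ℝ ∞ η) : IntegrableOn (fun t => w t * deriv η t) (Ioo 0 T) := by
  have h : IntegrableOn w (Icc 0 T) := by rwa [integrableOn_Icc_iff_integrableOn_Ioo]
  exact (h.mul_continuousOn (hη.continuous_deriv (by simp)).continuousOn isCompact_Icc).mono_set
    Ioo_subset_Icc_self

/-- The weak time derivative of an integrable function extended by zero to negative times. -/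
noncomputable def weakDeriv (w : ℝ → ℝ) (hw : IntegrableOn w (Ioo 0 T)) : Flux T where
  toFun η := -∫ t in Ioo 0 T, w t * deriv η.1 t
  map_add' f g := by
    have e : ∀ t, deriv (f + g).1 t = deriv f.1 t + deriv g.1 t := fun t =>
      deriv_add (f.2.1.differentiable (by simp) t) (g.2.1.differentiable (by simp) t)
    simp only [e, mul_add]
    rw [integral_add (integrable_mul_deriv hw f.2.1) (integrable_mul_deriv hw g.2.1), neg_add]
  map_smul' r f := by
    have e : ∀ t, deriv (r • f).1 t = r * deriv f.1 t := fun t =>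
      deriv_const_mul r (f.2.1.differentiable (by simp) t)
    simp only [e, mul_left_comm _ r, RingHom.id_apply, smul_eq_mul]
    rw [integral_const_mul, mul_neg]

theorem weakDeriv_apply (w : ℝ → ℝ) (hw : IntegrableOn w (Ioo 0 T)) (η : timeTest T) :
    weakDeriv w hw η = -∫ t in Ioo 0 T, w t * deriv η.1 t := rfl

theorem weakDeriv_congr {v w : ℝ → ℝ} (hv : IntegrableOn v (Ioo 0 T))
    (hw : IntegrableOn w (Ioo 0 T)) (h : v =ᵐ[volume.restrict (Ioo 0 T)] w) :
    weakDeriv v hv = weakDeriv w hw := by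
  ext η
  rw [weakDeriv_apply, weakDeriv_apply]
  congr 1
  exact integral_congr_ae (by filter_upwards [h] with t ht; rw [ht])

theorem weakDeriv_eq_zero {w : ℝ → ℝ} (hw : IntegrableOn w (Ioo 0 T))
    (h : w =ᵐ[volume.restrict (Ioo 0 T)] 0) : weakDeriv w hw = 0 := by
  ext η
  rw [weakDeriv_apply, integral_congr_ae (g := fun _ => 0)]
  · simp
  · filter_upwards [h] with t ht
    simp [ht]

/-- The time advance `η(t) ↦ η(t + d)`. -/
def advance (T d : ℝ) (hd : 0 ≤ d) : timeTest T →ₗ[ℝ] timeTest T where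
  toFun η := ⟨fun t => η.1 (t + d), η.2.1.comp (contDiff_id.add contDiff_const), by
    obtain ⟨τ, hτ, h0⟩ := η.2.2
    exact ⟨τ, hτ, fun t ht => h0 _ (by linarith)⟩⟩
  map_add' _ _ := rfl
  map_smul' _ _ := rfl

/-- The time delay of a generalised function, dual to `advance`. -/
def delay (T d : ℝ) (hd : 0 ≤ d) : Flux T →ₗ[ℝ] Flux T := (advance T d hd).dualMap

theorem delay_apply {d : ℝ} (hd : 0 ≤ d) (p : Flux T) (η : timeTest T) :
    delay T d hd p η = p (advance T d hd η) := rfl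

/-- The generalised functions of time that vanish before the time `d`. -/
def supportedFrom (T d : ℝ) : Submodule ℝ (Flux T) where
  carrier := {p | ∀ η : timeTest T, (∀ t, d < t → η.1 t = 0) → p η = 0}
  zero_mem' := fun _ _ => rfl
  add_mem' := fun {p q} hp hq η hη => by simp [hp η hη, hq η hη]
  smul_mem' := fun r p hp η hη => by simp [hp η hη]

theorem supportedFrom_anti {d e : ℝ} (h : d ≤ e) : supportedFrom T e ≤ supportedFrom T d :=
  fun _ hp η hη => hp η fun t ht => hη t (h.trans_lt ht)

theorem eq_zero_of_mem_supportedFrom {d : ℝ} (h : T ≤ d) {p : Flux T}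
    (hp : p ∈ supportedFrom T d) : p = 0 := by
  ext η
  obtain ⟨τ, hτ, h0⟩ := η.2.2
  exact hp η fun t ht => h0 t (by linarith)

theorem delay_mem {d e : ℝ} (hd : 0 ≤ d) {p : Flux T} (hp : p ∈ supportedFrom T e) :
    delay T d hd p ∈ supportedFrom T (e + d) :=
  fun _ hη => hp _ fun t ht => hη (t + d) (by linarith)

theorem weakDeriv_mem {w : ℝ → ℝ} (hw : IntegrableOn w (Ioo 0 T)) :
    weakDeriv w hw ∈ supportedFrom T 0 := by
  intro η hη
  rw [weakDeriv_apply, setIntegral_congr_fun (g := fun _ => 0) measurableSet_Ioo]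
  · simp
  · intro t ht
    have : η.1 =ᶠ[nhds t] fun _ => 0 := by
      filter_upwards [lt_mem_nhds ht.1] with s hs using hη s hs
    simp [this.deriv_eq]

/-- A function whose weak derivative vanishes is zero, because of the zero initial value. -/
theorem ae_eq_zero_of_weakDeriv_eq_zero {w : ℝ → ℝ} (hw : IntegrableOn w (Ioo 0 T))
    (h : weakDeriv w hw = 0) : w =ᵐ[volume.restrict (Ioo 0 T)] 0 := by
  have key := isOpen_Ioo.ae_eq_zero_of_integral_contDiff_smul_eq_zero (μ := volume)
    hw.locallyIntegrableOn (by
    intro g hg hgc hgs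
    -- The primitive based at `T` vanishes near `T` and need not vanish at `0`. It is an admissible
    -- test function for that reason, and no constant of integration is left over.
    set f : ℝ → ℝ := fun t => ∫ s in T..t, g s with hf
    have hd : ∀ t, HasDerivAt f (g t) t := fun t =>
      intervalIntegral.integral_hasDerivAt_right (hg.continuous.intervalIntegrable _ _)
        hg.continuous.aestronglyMeasurable.stronglyMeasurableAtFilter hg.continuous.continuousAt
    have hdf : deriv f = g := funext fun t => (hd t).deriv
    have hfs : ContDiff ℝ ∞ f := by
      rw [contDiff_infty_iff_deriv]
      exact ⟨fun t => (hd t).differentiableAt, hdf ▸ hg⟩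
    obtain ⟨τ, hτ, h0⟩ : ∃ τ < T, ∀ t, τ < t → g t = 0 := by
      rcases (tsupport g).eq_empty_or_nonempty with he | hne
      · exact ⟨T - 1, by linarith, fun t _ => by
          by_contra hgt
          have := subset_tsupport g hgt
          simp [he] at this⟩
      · obtain ⟨τ, hτm, hτ⟩ := hgc.isCompact.exists_isGreatest hne
        refine ⟨τ, (hgs hτm).2, fun t ht => ?_⟩
        by_contra hgt
        exact absurd (hτ (subset_tsupport g hgt)) (not_le.2 ht)
    have hfm : f ∈ timeTest T := by
      refine ⟨hfs, (τ + T) / 2, by linarith, fun t ht => ?_⟩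
      rw [hf]
      refine intervalIntegral.integral_zero_ae (Filter.Eventually.of_forall fun s hs => h0 s ?_)
      rcases le_total T t with h | h
      · rw [uIoc_of_le h] at hs; linarith [hs.1]
      · rw [uIoc_of_ge h] at hs; linarith [hs.1]
    have := congrArg (fun p : Flux T => p ⟨f, hfm⟩) h
    simp only [weakDeriv_apply, hdf, LinearMap.zero_apply, neg_eq_zero] at this
    rw [← this, ← integral_indicator measurableSet_Ioo]
    refine integral_congr_ae (Filter.Eventually.of_forall fun t => ?_)
    by_cases ht : t ∈ Ioo 0 T
    · simp [ht, mul_comm]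
    · have : g t = 0 := by
        by_contra hgt
        exact ht (hgs (subset_tsupport g hgt))
      simp [ht, this])
  rw [Filter.EventuallyEq, ae_restrict_iff' measurableSet_Ioo]
  exact key

end Filtration

/-! ### Transport relations on one subdomain, modulo a round trip. -/

section Algebra

variable {T m d : ℝ} {S : Flux T →ₗ[ℝ] Flux T}

/-- A coupled pair of generalised functions is supported where its data are: each round trip of the
coupling postpones the remainder. -/
theorem mem_of_coupled (hm : 0 < m) (hS : ∀ e, ∀ p ∈ supportedFrom T e, S p ∈ supportedFrom T (e + m))
    (a : ℝ) {X Y : Flux T} (hX : X ∈ supportedFrom T 0) (hY : Y ∈ supportedFrom T 0)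
    (h₁ : X - S Y ∈ supportedFrom T d) (h₂ : Y - a • S X ∈ supportedFrom T d) :
    X ∈ supportedFrom T d ∧ Y ∈ supportedFrom T d := by
  -- Substituting the relations into each other gains `m` per pass, starting from time 0; the gain
  -- stops at `d`, the support of the data.
  have key : ∀ n : ℕ, X ∈ supportedFrom T (min d (n * m)) ∧ Y ∈ supportedFrom T (min d (n * m)) := by
    intro n
    induction n with
    | zero =>
      exact ⟨supportedFrom_anti (by simp) hX, supportedFrom_anti (by simp) hY⟩
    | succ n ih =>
      have hle : min d ((n + 1 : ℕ) * m) ≤ min d (n * m) + m := by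
        rw [← min_add_add_right]
        push_cast
        exact min_le_min (by linarith) (by linarith)
      have hXS := supportedFrom_anti hle (hS _ _ ih.1)
      have hYS := supportedFrom_anti hle (hS _ _ ih.2)
      constructor
      · have := add_mem (supportedFrom_anti (min_le_left _ _) h₁) hYS
        rwa [sub_add_cancel] at this
      · have := add_mem (supportedFrom_anti (min_le_left _ _) h₂) (Submodule.smul_mem _ a hXS)
        rwa [sub_add_cancel] at this
  obtain ⟨n, hn⟩ := exists_nat_ge (d / m)
  have : d ≤ min d (n * m) := le_min le_rfl ((div_le_iff₀ hm).1 hn)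
  exact ⟨supportedFrom_anti this (key n).1, supportedFrom_anti this (key n).2⟩

/-- The relations between the Dirichlet data `W` and the fluxes `P` on a subdomain, with `S` the
delay by its crossing time: both Riemann invariants are transported to the opposite end. -/
structure Transported (S : Flux T →ₗ[ℝ] Flux T) (WL WR PL PR : Flux T) : Prop where
  left : PL + WL = S (PR + WR)
  right : PR - WR = S (PL - WL)

variable {WL WR PL PR : Flux T}

theorem mem_two (hS : ∀ e, ∀ p ∈ supportedFrom T e, S p ∈ supportedFrom T (e + m)) {p : Flux T}
    (hp : p ∈ supportedFrom T d) : S (S p) ∈ supportedFrom T (d + 2 * m) :=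
  (show d + m + m = d + 2 * m by ring) ▸ hS _ _ (hS _ _ hp)

/-- With the Dirichlet data known, the transport relations couple the two fluxes through `S`, so
`mem_of_coupled` applies. This is causality of the Dirichlet problem. -/
theorem Transported.flux_mem (h : Transported S WL WR PL PR) (hm : 0 < m)
    (hS : ∀ e, ∀ p ∈ supportedFrom T e, S p ∈ supportedFrom T (e + m))
    (hWL : WL ∈ supportedFrom T d) (hWR : WR ∈ supportedFrom T d)
    (hPL : PL ∈ supportedFrom T 0) (hPR : PR ∈ supportedFrom T 0) :
    PL ∈ supportedFrom T d ∧ PR ∈ supportedFrom T d := by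
  have hS' : ∀ p ∈ supportedFrom T d, S p ∈ supportedFrom T d := fun p hp =>
    supportedFrom_anti (by linarith) (hS _ p hp)
  refine mem_of_coupled hm hS 1 hPL hPR ?_ ?_
  · have e : PL - S PR = S WR - WL := by
      have := h.left
      rw [map_add] at this
      rw [eq_sub_of_add_eq this]; abel
    exact e ▸ sub_mem (hS' _ hWR) hWL
  · have e : PR - (1 : ℝ) • S PL = WR - S WL := by
      have := h.right
      rw [map_sub] at this
      rw [eq_add_of_sub_eq this]; module
    exact e ▸ sub_mem hWR (hS' _ hWL)

/-- Eliminating the opposite flux leaves an exact remainder `S (S _)`, a wave that has crossed the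
subdomain twice; it gains `2 * m`. -/
theorem Transported.flux_approx (h : Transported S WL WR PL PR)
    (hS : ∀ e, ∀ p ∈ supportedFrom T e, S p ∈ supportedFrom T (e + m))
    (hWL : WL ∈ supportedFrom T d) (hWR : WR ∈ supportedFrom T d)
    (hPL : PL ∈ supportedFrom T d) (hPR : PR ∈ supportedFrom T d) :
    PL - ((2 : ℝ) • S WR - WL) ∈ supportedFrom T (d + 2 * m) ∧
      PR - (WR - (2 : ℝ) • S WL) ∈ supportedFrom T (d + 2 * m) := by
  have hl := eq_sub_of_add_eq h.left
  have hr := eq_add_of_sub_eq h.right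
  constructor
  · have e : PL - ((2 : ℝ) • S WR - WL) = S (S (PL - WL)) := by
      rw [← h.right, hl]
      simp only [map_add, map_sub]
      module
    exact e ▸ mem_two hS (sub_mem hPL hWL)
  · have e : PR - (WR - (2 : ℝ) • S WL) = S (S (PR + WR)) := by
      rw [← h.left, hr]
      simp only [map_add, map_sub]
      module
    exact e ▸ mem_two hS (add_mem hPR hWR)

theorem Transported.dirichlet_mem (h : Transported S WL WR PL PR) (hm : 0 < m)
    (hS : ∀ e, ∀ p ∈ supportedFrom T e, S p ∈ supportedFrom T (e + m))
    (hWL : WL ∈ supportedFrom T 0) (hWR : WR ∈ supportedFrom T 0)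
    (hPL : PL ∈ supportedFrom T d) (hPR : PR ∈ supportedFrom T d) :
    WL ∈ supportedFrom T d ∧ WR ∈ supportedFrom T d := by
  have hS' : ∀ p ∈ supportedFrom T d, S p ∈ supportedFrom T d := fun p hp =>
    supportedFrom_anti (by linarith) (hS _ p hp)
  refine mem_of_coupled hm hS 1 hWL hWR ?_ ?_
  · have e : WL - S WR = S PR - PL := by
      have := h.left
      rw [map_add] at this
      rw [eq_sub_of_add_eq' this]; abel
    exact e ▸ sub_mem (hS' _ hPR) hPL
  · have e : WR - (1 : ℝ) • S WL = PR - S PL := by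
      have := h.right
      rw [map_sub] at this
      rw [eq_add_of_sub_eq this]; module
    exact e ▸ sub_mem hPR (hS' _ hPL)

/-- The relations are symmetric, up to signs, under exchange of `W` and `P`, so the Neumann problem
has the same first-order expansion with a round-trip remainder. -/
theorem Transported.dirichlet_approx (h : Transported S WL WR PL PR)
    (hS : ∀ e, ∀ p ∈ supportedFrom T e, S p ∈ supportedFrom T (e + m))
    (hWL : WL ∈ supportedFrom T d) (hWR : WR ∈ supportedFrom T d)
    (hPL : PL ∈ supportedFrom T d) (hPR : PR ∈ supportedFrom T d) :
    WL - ((2 : ℝ) • S PR - PL) ∈ supportedFrom T (d + 2 * m) ∧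
      WR - (PR - (2 : ℝ) • S PL) ∈ supportedFrom T (d + 2 * m) := by
  have hl := eq_sub_of_add_eq' h.left
  have hr := h.right
  constructor
  · have e : WL - ((2 : ℝ) • S PR - PL) = - S (S (PL - WL)) := by
      rw [← h.right, hl]
      simp only [map_add, map_sub]
      module
    exact e ▸ neg_mem (mem_two hS (sub_mem hPL hWL))
  · have e : WR - (PR - (2 : ℝ) • S PL) = S (S (PR + WR)) := by
      rw [← h.left, (by rw [← hr]; abel : WR = PR - S (PL - WL))]
      simp only [map_add, map_sub]
      module
    exact e ▸ mem_two hS (add_mem hPR hWR)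

/-- Dirichlet condition on the left, Neumann condition on the right. -/
theorem Transported.mixed_left (h : Transported S 0 WR PL PR) (hm : 0 < m)
    (hS : ∀ e, ∀ p ∈ supportedFrom T e, S p ∈ supportedFrom T (e + m))
    (hWR : WR ∈ supportedFrom T 0) (hPL : PL ∈ supportedFrom T 0) (hPR : PR ∈ supportedFrom T d) :
    WR - PR ∈ supportedFrom T (d + 2 * m) := by
  have hS' : ∀ p ∈ supportedFrom T d, S p ∈ supportedFrom T d := fun p hp =>
    supportedFrom_anti (by linarith) (hS _ p hp)
  have hl := h.left
  have hr := h.right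
  simp only [add_zero, sub_zero] at hl hr
  -- The unknowns satisfy `PL - S WR = S PR` and `WR + S PL = PR`; the mixed boundary conditions
  -- produce the coefficient -1. The effect of the Dirichlet end returns only after two crossings,
  -- so there is no first-order term.
  have h' := mem_of_coupled hm hS (-1) hPL hWR (d := d)
    (by rw [hl, map_add, add_sub_cancel_right]; exact hS' _ hPR)
    (by rw [← hr, (by module : WR - (-1 : ℝ) • (PR - WR) = PR)]; exact hPR)
  have e : WR - PR = - S (S (PR + WR)) := by rw [← hl, ← hr]; abel
  exact e ▸ neg_mem (mem_two hS (add_mem hPR h'.2))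

/-- Neumann condition on the left, Dirichlet condition on the right. -/
theorem Transported.mixed_right (h : Transported S WL 0 PL PR) (hm : 0 < m)
    (hS : ∀ e, ∀ p ∈ supportedFrom T e, S p ∈ supportedFrom T (e + m))
    (hWL : WL ∈ supportedFrom T 0) (hPR : PR ∈ supportedFrom T 0) (hPL : PL ∈ supportedFrom T d) :
    WL + PL ∈ supportedFrom T (d + 2 * m) := by
  have hS' : ∀ p ∈ supportedFrom T d, S p ∈ supportedFrom T d := fun p hp =>
    supportedFrom_anti (by linarith) (hS _ p hp)
  have hl := h.left
  have hr := h.right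
  simp only [add_zero, sub_zero] at hl hr
  have h' := mem_of_coupled hm hS (-1) hWL hPR (d := d)
    (by rw [← hl, (by abel : WL - (PL + WL) = -PL)]; exact neg_mem hPL)
    (by rw [hr, map_sub, (by module : S PL - S WL - (-1 : ℝ) • S WL = S PL)]; exact hS' _ hPL)
  have e : WL + PL = S (S (PL - WL)) := by rw [← hr, ← hl]; abel
  exact e ▸ mem_two hS (sub_mem hPL h'.1)

end Algebra

/-! ### Transport of the Riemann invariants, from Green's formula. -/

section Characteristics

theorem deriv_comp_affine {f : ℝ → ℝ} (hf : Differentiable ℝ f) (s α x : ℝ) :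
    deriv (fun y => f (s * y + α)) x = s * deriv f (s * x + α) := by
  have h : HasDerivAt (fun y => s * y + α) s x := by
    simpa using ((hasDerivAt_id x).const_mul s).add_const α
  simpa [mul_comm, Function.comp_def] using ((hf (s * x + α)).hasDerivAt.comp x h).deriv

theorem iteratedDeriv_two_comp_affine {f : ℝ → ℝ} (hf : ContDiff ℝ ∞ f) (s α x : ℝ) :
    iteratedDeriv 2 (fun y => f (s * y + α)) x = s ^ 2 * iteratedDeriv 2 f (s * x + α) := by
  have hf' : Differentiable ℝ (deriv f) :=
    (contDiff_infty_iff_deriv.1 hf).2.differentiable (by simp)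
  simp only [iteratedDeriv_succ, iteratedDeriv_zero]
  rw [funext fun y => deriv_comp_affine (hf.differentiable (by simp)) s α y,
    deriv_const_mul_field, deriv_comp_affine hf']
  ring

variable {c a b T : ℝ} {u : ℝ × ℝ → ℝ} {tr : Traces T}

/-- Green's formula for a product test function with affine profile in space. -/
theorem IsWeakSolution.green_affine (h : IsWeakSolution c a b T u tr) (hc : 0 < c) {η : timeTest T}
    (hη : ∀ t, 0 < t → η.1 t = 0) (α β : ℝ) :
    (α * b + β) * tr.dxR η = (α * a + β) * tr.dxL η := by
  have hψ : IsSpaceTimeTest T (fun p => (α * p.1 + β) * η.1 p.2) := by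
    obtain ⟨hs, τ, hτ, h0⟩ := η.2
    exact ⟨((contDiff_const.mul contDiff_fst).add contDiff_const).mul (hs.comp contDiff_snd), τ, hτ,
      fun x t ht => by simp [h0 t ht]⟩
  have hsl : ∀ x, hψ.slice x = (α * x + β) • η := fun x => rfl
  have key := h.green _ hψ
  rw [hsl, hsl, setIntegral_congr_fun (g := fun _ => 0) (measurableSet_Ioo.prod measurableSet_Ioo),
    setIntegral_congr_fun (f := fun t => tr.dirR t * _) (g := fun _ => 0) measurableSet_Ioo,
    setIntegral_congr_fun (f := fun t => tr.dirL t * _) (g := fun _ => 0) measurableSet_Ioo] at key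
  · simp only [integral_zero, map_smul, smul_eq_mul, sub_zero, add_zero] at key
    have := (mul_eq_zero.1 key.symm).resolve_left (by positivity)
    linarith
  · intro t ht
    simp [hη t ht.1]
  · intro t ht
    simp [hη t ht.1]
  · intro p hp
    have : (fun t => (α * p.1 + β) * η.1 t) =ᶠ[nhds p.2] fun _ => 0 := by
      filter_upwards [lt_mem_nhds hp.2.1] with s hs
      simp [hη s hs]
    simp [this.iteratedDeriv_eq 2, hη p.2 hp.2.1]

/-- A flux is an abstract functional, so its causality has to be derived. If the test function
vanishes for positive times, all integrals in Green's formula vanish; a profile that is zero at the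
other end isolates this flux. -/
theorem IsWeakSolution.dxR_mem (h : IsWeakSolution c a b T u tr) (hc : 0 < c) (hab : a < b) :
    tr.dxR ∈ supportedFrom T 0 := fun η hη => by
  have := h.green_affine hc hη 1 (-a)
  have : (b - a) * tr.dxR η = 0 := by linarith
  exact (mul_eq_zero.1 this).resolve_left (by linarith)

theorem IsWeakSolution.dxL_mem (h : IsWeakSolution c a b T u tr) (hc : 0 < c) (hab : a < b) :
    tr.dxL ∈ supportedFrom T 0 := fun η hη => by
  have := h.green_affine hc hη 1 (-b)
  have : (b - a) * tr.dxL η = 0 := by linarith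
  exact (mul_eq_zero.1 this).resolve_left (by linarith)

/-- Green's formula for the travelling wave `f(t + s(x - e))` with `s = ± 1 / c`. -/
theorem IsWeakSolution.delay_eq (h : IsWeakSolution c a b T u tr) (hc : 0 < c) (hab : a < b)
    {s : ℝ} (hs : c ^ 2 * s ^ 2 = 1) (e : ℝ) (hb : 0 ≤ s * (b - e)) (ha : 0 ≤ s * (a - e)) :
    delay T (s * (b - e)) hb (tr.dxR + s • weakDeriv tr.dirR h.integrable_dirR) =
      delay T (s * (a - e)) ha (tr.dxL + s • weakDeriv tr.dirL h.integrable_dirL) := by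
  ext f
  obtain ⟨hf, τ, hτ, h0⟩ := f.2
  -- A travelling wave does not vanish near `T` uniformly in `x`, so it is cut off in space. The
  -- margin `ε` around `[a, b]` is so small that the phase is at least `-(T - τ) / 2` there, and the
  -- product vanishes for `t ≥ (τ + T) / 2`.
  set ε : ℝ := (T - τ) / (2 * (|s| + 1)) with hε
  have hε0 : 0 < ε := by
    have : 0 < T - τ := by linarith
    positivity
  have hsε : |s| * ε ≤ (T - τ) / 2 := by
    have e1 : (|s| + 1) * ε = (T - τ) / 2 := by
      rw [hε]; field_simp
    nlinarith
  let χ : ContDiffBump ((a + b) / 2) := ⟨(b - a) / 2 + ε / 2, (b - a) / 2 + ε, by linarith, by linarith⟩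
  have hχ1 : ∀ x, a - ε / 2 < x → x < b + ε / 2 → χ x = 1 := fun x h1 h2 =>
    χ.one_of_mem_closedBall (by
      rw [Metric.mem_closedBall, Real.dist_eq, abs_le]
      constructor <;> simp only [χ] <;> linarith)
  have hψ : IsSpaceTimeTest T (fun p => χ p.1 * f.1 (p.2 + s * (p.1 - e))) := by
    refine ⟨(χ.contDiff.comp contDiff_fst).mul (hf.comp
      (contDiff_snd.add (contDiff_const.mul (contDiff_fst.sub contDiff_const)))), (τ + T) / 2,
      by linarith, fun x t ht => ?_⟩
    by_cases hx : dist x ((a + b) / 2) < (b - a) / 2 + ε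
    · rw [Real.dist_eq, abs_lt] at hx
      have : -((T - τ) / 2) ≤ s * (x - e) := by
        rcases le_total 0 s with h | h
        · rw [abs_of_nonneg h] at hsε
          nlinarith
        · rw [abs_of_nonpos h] at hsε
          nlinarith
      simp only
      rw [h0 _ (by linarith), mul_zero]
    · simp only
      rw [χ.zero_of_le_dist (not_lt.1 hx), zero_mul]
  have hsl : ∀ x (hx : 0 ≤ s * (x - e)), a ≤ x → x ≤ b →
      hψ.slice x = advance T (s * (x - e)) hx f := fun x _ h1 h2 => by
    apply Subtype.ext
    funext t
    change χ x * _ = f.1 _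
    rw [hχ1 x (by linarith) (by linarith), one_mul]
  have hev : ∀ x t, a ≤ x → x ≤ b → (fun y => χ y * f.1 (t + s * (y - e))) =ᶠ[nhds x]
      fun y => f.1 (s * y + (t - s * e)) := fun x t h1 h2 => by
    filter_upwards [Ioo_mem_nhds (by linarith : a - ε / 2 < x) (by linarith : x < b + ε / 2)]
      with y hy
    rw [hχ1 y hy.1 hy.2, one_mul]
    ring_nf
  have hdx : ∀ x t, a ≤ x → x ≤ b → deriv (fun y => χ y * f.1 (t + s * (y - e))) x
      = s * deriv (fun r => f.1 (r + s * (x - e))) t := fun x t h1 h2 => by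
    rw [(hev x t h1 h2).deriv_eq, deriv_comp_affine (hf.differentiable (by simp)),
      deriv_comp_add_const]
    ring_nf
  have key := h.green _ hψ
  rw [hsl b hb hab.le le_rfl, hsl a ha le_rfl hab.le,
    setIntegral_congr_fun (g := fun _ => 0) (measurableSet_Ioo.prod measurableSet_Ioo)] at key
  · simp only [hdx b _ hab.le le_rfl, hdx a _ le_rfl hab.le, mul_left_comm _ s, integral_zero,
      integral_const_mul] at key
    have := (mul_eq_zero.1 key.symm).resolve_left (by positivity)
    simp only [delay_apply, LinearMap.add_apply, LinearMap.smul_apply, weakDeriv_apply, smul_eq_mul]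
    simp only [advance, LinearMap.coe_mk, AddHom.coe_mk] at this ⊢
    linarith
  -- The cutoff is 1 near the interval, and the travelling wave solves the wave equation because `c
  -- ^ 2 * s ^ 2 = 1`.
  · intro p hp
    have e1 : (fun t => χ p.1 * f.1 (t + s * (p.1 - e))) =
        fun t => f.1 (1 * t + s * (p.1 - e)) := by
      rw [hχ1 p.1 (by linarith [hp.1.1]) (by linarith [hp.1.2])]
      simp
    simp only
    rw [e1, (hev p.1 p.2 hp.1.1.le hp.1.2.le).iteratedDeriv_eq 2,
      iteratedDeriv_two_comp_affine hf, iteratedDeriv_two_comp_affine hf, ← mul_assoc (c ^ 2), hs,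
      (by ring : s * p.1 + (p.2 - s * e) = 1 * p.2 + s * (p.1 - e))]
    ring

theorem delay_zero (h : (0 : ℝ) ≤ 0) (p : Flux T) : delay T 0 h p = p := by
  ext η
  rw [delay_apply]
  congr 1
  apply Subtype.ext
  funext t
  change η.1 (t + 0) = _
  rw [add_zero]

theorem delay_congr {d e : ℝ} (h : d = e) (hd : 0 ≤ d) (he : 0 ≤ e) :
    delay T d hd = delay T e he := by
  subst h
  rfl

/-- The two relations come from the two directions of travel: slope `1 / c` anchored at `a` and
slope `-1 / c` anchored at `b`. The delay is zero at the anchor and equals the crossing time at the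
other end. -/
theorem IsWeakSolution.transported (h : IsWeakSolution c a b T u tr) (hc : 0 < c) (hab : a < b)
    (hd : 0 ≤ (b - a) / c) :
    Transported (delay T ((b - a) / c) hd) (c⁻¹ • weakDeriv tr.dirL h.integrable_dirL)
      (c⁻¹ • weakDeriv tr.dirR h.integrable_dirR) tr.dxL tr.dxR := by
  have e1 : c⁻¹ * (b - a) = (b - a) / c := by ring
  have e2 : -c⁻¹ * (a - b) = (b - a) / c := by ring
  constructor
  · have := h.delay_eq hc hab (s := c⁻¹) (by field_simp) a (e1 ▸ hd) (by simp)
    rw [delay_congr e1 _ hd, delay_congr (by simp : c⁻¹ * (a - a) = 0) _ le_rfl, delay_zero] at this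
    exact this.symm
  · have := h.delay_eq hc hab (s := -c⁻¹) (by field_simp) b (by simp) (e2 ▸ hd)
    rw [delay_congr e2 _ hd, delay_congr (by simp : -c⁻¹ * (b - b) = 0) _ le_rfl, delay_zero] at this
    have e3 : ∀ p q : Flux T, p - c⁻¹ • q = p + -c⁻¹ • q := fun p q => by module
    rw [e3, e3]
    exact this

end Characteristics

/-! ### Uniqueness by duality with the backward wave equation. -/

section Uniqueness

theorem hasFDerivAt_segment_integral {E F : Type} [NormedAddCommGroup E] [NormedSpace ℝ E]
    [FiniteDimensional ℝ E] [NormedAddCommGroup F] [NormedSpace ℝ F] {f : E → F}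
    (hf : ContDiff ℝ 1 f) (v : E) (M : ℝ) (x₀ : E) :
    HasFDerivAt (fun x => ∫ s in (0 : ℝ)..M, f (x + s • v))
      (∫ s in (0 : ℝ)..M, fderiv ℝ f (x₀ + s • v)) x₀ := by
  have hc : Continuous fun q : E × ℝ => q.1 + q.2 • v := by fun_prop
  have hd : Continuous (fderiv ℝ f) := hf.continuous_fderiv one_ne_zero
  obtain ⟨C, hC⟩ := ((isCompact_closedBall x₀ 1).prod (isCompact_uIcc (a := (0 : ℝ)) (b := M))).exists_bound_of_continuousOn
    (hd.comp hc).continuousOn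
  refine intervalIntegral.hasFDerivAt_integral_of_dominated_of_fderiv_le (𝕜 := ℝ)
    (F := fun x s => f (x + s • v)) (F' := fun x s => fderiv ℝ f (x + s • v))
    (bound := fun _ => C) (Metric.closedBall_mem_nhds x₀ one_pos) ?_ ?_ ?_ ?_ ?_ ?_
  · exact Filter.Eventually.of_forall fun x =>
      (hf.continuous.comp (hc.comp (Continuous.prodMk_right x))).aestronglyMeasurable
  · exact (hf.continuous.comp (hc.comp (Continuous.prodMk_right x₀))).intervalIntegrable _ _
  · exact (hd.comp (hc.comp (Continuous.prodMk_right x₀))).aestronglyMeasurable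
  · exact Filter.Eventually.of_forall fun s hs x hx => hC (x, s) ⟨hx, uIoc_subset_uIcc hs⟩
  · exact intervalIntegrable_const
  · refine Filter.Eventually.of_forall fun s _ x _ => ?_
    have h := ((hf.differentiable one_ne_zero) (x + s • v)).hasFDerivAt
    exact (hasFDerivAt_comp_add_right (s • v)).2 h

/-- The codomain is quantified inside the induction because each step passes from `f` to `fderiv ℝ
f`. -/
theorem contDiff_segment_integral_nat {E : Type} [NormedAddCommGroup E] [NormedSpace ℝ E]
    [FiniteDimensional ℝ E] (v : E) (M : ℝ) (n : ℕ) :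
    ∀ {F : Type} [NormedAddCommGroup F] [NormedSpace ℝ F] {f : E → F}, ContDiff ℝ n f →
      ContDiff ℝ n (fun x => ∫ s in (0 : ℝ)..M, f (x + s • v)) := by
  induction n with
  | zero =>
    intro F _ _ f hf
    have h0 : Continuous f := hf.continuous
    refine contDiff_zero.2 ?_
    exact intervalIntegral.continuous_parametric_intervalIntegral_of_continuous' (by fun_prop) 0 M
  | succ n ih =>
    intro F _ _ f hf
    have h1 := hasFDerivAt_segment_integral (hf.of_le (by simp)) v M
    push_cast at hf ⊢
    refine contDiff_succ_iff_fderiv.2 ⟨fun x => (h1 x).differentiableAt, by simp, ?_⟩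
    rw [funext fun x => (h1 x).fderiv]
    exact ih (contDiff_succ_iff_fderiv.1 hf).2.2

theorem contDiff_segment_integral {E F : Type} [NormedAddCommGroup E] [NormedSpace ℝ E]
    [FiniteDimensional ℝ E] [NormedAddCommGroup F] [NormedSpace ℝ F] {f : E → F}
    (hf : ContDiff ℝ ∞ f) (v : E) (M : ℝ) :
    ContDiff ℝ ∞ (fun x => ∫ s in (0 : ℝ)..M, f (x + s • v)) :=
  contDiff_infty.2 fun n => contDiff_segment_integral_nat v M n (contDiff_infty.1 hf n)

/-- Integration along `v` inverts the directional derivative along `v`, up to the sign and the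
endpoint value. -/
theorem fderiv_segment_integral {E F : Type} [NormedAddCommGroup E] [NormedSpace ℝ E]
    [FiniteDimensional ℝ E] [NormedAddCommGroup F] [NormedSpace ℝ F] [CompleteSpace F] {f : E → F}
    (hf : ContDiff ℝ ∞ f) (v : E) (M : ℝ) (x : E) :
    fderiv ℝ (fun x => ∫ s in (0 : ℝ)..M, f (x + s • v)) x v = f (x + M • v) - f x := by
  have hd : Continuous (fderiv ℝ f) := hf.continuous_fderiv (by simp)
  have hl : Continuous fun s : ℝ => x + s • v := by fun_prop
  rw [(hasFDerivAt_segment_integral (hf.of_le (by simp)) v M x).fderiv,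
    ContinuousLinearMap.intervalIntegral_apply (φ := fun s : ℝ => fderiv ℝ f (x + s • v))
      ((hd.comp hl).intervalIntegrable _ _),
    intervalIntegral.integral_eq_sub_of_hasDerivAt (f := fun s : ℝ => f (x + s • v))]
  · simp
  · intro s _
    have h1 : HasDerivAt (fun s : ℝ => x + s • v) v s := by
      simpa using ((hasDerivAt_id s).smul_const v).const_add x
    exact ((hf.differentiable (by simp)) (x + s • v)).hasFDerivAt.comp_hasDerivAt s h1
  · exact ((hd.comp hl).clm_apply continuous_const).intervalIntegrable _ _

theorem iteratedDeriv_two_comp_line {E : Type} [NormedAddCommGroup E] [NormedSpace ℝ E]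
    {ψ : E → ℝ} (hψ : ContDiff ℝ ∞ ψ) {ℓ : ℝ → E} {v : E} (hℓ : ∀ t, HasDerivAt ℓ v t) (t : ℝ) :
    iteratedDeriv 2 (fun t => ψ (ℓ t)) t = fderiv ℝ (fderiv ℝ ψ) (ℓ t) v v := by
  have hd : ContDiff ℝ ∞ (fderiv ℝ ψ) := (contDiff_infty_iff_fderiv.1 hψ).2
  have e1 : deriv (fun t => ψ (ℓ t)) = fun t => fderiv ℝ ψ (ℓ t) v := funext fun t =>
    ((hψ.differentiable (by simp) _).hasFDerivAt.comp_hasDerivAt t (hℓ t)).deriv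
  simp only [iteratedDeriv_succ, iteratedDeriv_zero]
  rw [e1]
  have h2 := (hd.differentiable (by simp) (ℓ t)).hasFDerivAt.comp_hasDerivAt t (hℓ t)
  have h3 := h2.clm_apply (hasDerivAt_const t v)
  simpa using h3.deriv

/-- Factorisation of the wave operator into two transport operators. -/
theorem wave_factor {ψ : ℝ × ℝ → ℝ} (hψ : ContDiff ℝ ∞ ψ) (c : ℝ) (p : ℝ × ℝ) :
    iteratedDeriv 2 (fun t => ψ (p.1, t)) p.2 - c ^ 2 * iteratedDeriv 2 (fun x => ψ (x, p.2)) p.1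
      = fderiv ℝ (fun q => fderiv ℝ ψ q (-c, 1)) p (c, 1) := by
  have hd : ContDiff ℝ ∞ (fderiv ℝ ψ) := (contDiff_infty_iff_fderiv.1 hψ).2
  have hsymm : IsSymmSndFDerivAt ℝ ψ p := 
    (contDiff_infty.1 hψ 2).contDiffAt.isSymmSndFDerivAt (by simp)
  rw [iteratedDeriv_two_comp_line hψ (ℓ := fun t => (p.1, t)) (fun t => (hasDerivAt_const t p.1).prodMk (hasDerivAt_id t)),
    iteratedDeriv_two_comp_line hψ (ℓ := fun x => (x, p.2)) (fun t => (hasDerivAt_id t).prodMk (hasDerivAt_const t p.2)),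
    fderiv_clm_apply (hd.differentiable (by simp) p) (differentiableAt_const _)]
  have e1 : ((c, 1) : ℝ × ℝ) = c • ((1, 0) : ℝ × ℝ) + (0, 1) := by simp
  have e2 : ((-c, 1) : ℝ × ℝ) = (-c) • ((1, 0) : ℝ × ℝ) + (0, 1) := by simp
  have e3 := hsymm (1, 0) (0, 1)
  rw [e1, e2]
  simp only [map_add, map_smul, add_apply, smul_apply,
    ContinuousLinearMap.flip_apply, ContinuousLinearMap.comp_apply, smul_eq_mul, fderiv_fun_const,
    Pi.zero_apply, zero_apply, map_zero, zero_add]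
  rw [e3]
  ring

/-- The backward wave equation on the line with zero final data, on positive times. -/
theorem exists_backward_solution {T : ℝ} (c : ℝ) (hT : 0 < T) {g : ℝ × ℝ → ℝ}
    (hg : ContDiff ℝ ∞ g) {τ : ℝ} (hτ : τ < T) (h0 : ∀ x t, τ ≤ t → g (x, t) = 0) :
    ∃ ψ, IsSpaceTimeTest T ψ ∧ ∀ p : ℝ × ℝ, 0 < p.2 →
      iteratedDeriv 2 (fun t => ψ (p.1, t)) p.2
        - c ^ 2 * iteratedDeriv 2 (fun x => ψ (x, p.2)) p.1 = g p := by
  -- Each transport factor of the wave operator is inverted by integrating along its own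
  -- characteristics. From a positive time, length `T` reaches beyond `T`, where `g` vanishes, so
  -- the endpoint terms drop out.
  let G : ℝ × ℝ → ℝ := fun p => ∫ s in (0 : ℝ)..T, g (p + s • (c, 1))
  let ψ : ℝ × ℝ → ℝ := fun p => ∫ s in (0 : ℝ)..T, G (p + s • (-c, 1))
  have hG : ContDiff ℝ ∞ G := contDiff_segment_integral hg _ _
  have hψ : ContDiff ℝ ∞ ψ := contDiff_segment_integral hG _ _
  have vanish : ∀ (f : ℝ × ℝ → ℝ) (e : ℝ), (∀ x t, τ ≤ t → f (x, t) = 0) →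
      ∀ x t, τ ≤ t → ∫ s in (0 : ℝ)..T, f ((x, t) + s • (e, (1 : ℝ))) = 0 := by
    intro f e hf x t ht
    refine intervalIntegral.integral_zero_ae (Filter.Eventually.of_forall fun s hs => ?_)
    rw [uIoc_of_le hT.le] at hs
    exact hf _ _ (by simp only [Prod.smul_snd, smul_eq_mul]; linarith [hs.1])
  have hG0 : ∀ x t, τ ≤ t → G (x, t) = 0 := vanish g c h0
  refine ⟨ψ, ⟨hψ, τ, hτ, vanish G (-c) hG0⟩, fun p hp => ?_⟩
  have hGd : ∀ q, fderiv ℝ G q (c, 1) = g (q + T • (c, 1)) - g q :=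
    fun q => fderiv_segment_integral hg _ _ q
  have hψd : (fun q => fderiv ℝ ψ q (-c, 1)) = fun q => G (q + T • (-c, 1)) - G q :=
    funext fun q => fderiv_segment_integral hG _ _ q
  have hGdiff : Differentiable ℝ G := hG.differentiable (by simp)
  have late : ∀ q : ℝ × ℝ, T ≤ q.2 → g q = 0 := fun q hq => h0 q.1 q.2 (by linarith)
  rw [wave_factor hψ, hψd, fderiv_fun_sub (f := fun q => G (q + T • (-c, 1)))
      (hGdiff.comp (differentiable_id.add_const _) p) (hGdiff p),
    fderiv_comp_add_right, sub_apply, hGd, hGd, late, late, late]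
  · ring
  · simp; linarith
  · simp; linarith
  · simp; linarith

variable {c a b T : ℝ} {u : ℝ × ℝ → ℝ} {tr : Traces T}

/-- With zero boundary values, Green's formula for a backward solution with source `g` reads `∫ u g
= 0`, for every compactly supported smooth `g`. -/
theorem IsWeakSolution.ae_eq_zero (h : IsWeakSolution c a b T u tr) (hT : 0 < T)
    (hdL : tr.dirL =ᵐ[volume.restrict (Ioo 0 T)] 0) (hdR : tr.dirR =ᵐ[volume.restrict (Ioo 0 T)] 0)
    (hxL : tr.dxL = 0) (hxR : tr.dxR = 0) :
    u =ᵐ[volume.restrict (Ioo a b ×ˢ Ioo 0 T)] 0 := by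
  have hU : IsOpen (Ioo a b ×ˢ Ioo (0 : ℝ) T) := isOpen_Ioo.prod isOpen_Ioo
  have hz : ∀ {f : ℝ → ℝ} (g : ℝ → ℝ), f =ᵐ[volume.restrict (Ioo 0 T)] 0 →
      ∫ t in Ioo 0 T, f t * g t = 0 := fun g hf => by
    rw [integral_congr_ae (g := fun _ => 0), integral_zero]
    filter_upwards [hf] with t ht
    simp [ht]
  rw [Filter.EventuallyEq, ae_restrict_iff' hU.measurableSet]
  refine hU.ae_eq_zero_of_integral_contDiff_smul_eq_zero h.integrable.locallyIntegrableOn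
    fun g hg hgc hgs => ?_
  obtain ⟨τ, hτ, h0⟩ : ∃ τ < T, ∀ x t, τ ≤ t → g (x, t) = 0 := by
    rcases (tsupport g).eq_empty_or_nonempty with he | hne
    · exact ⟨T - 1, by linarith, fun x t _ => by
        by_contra hgt
        have := subset_tsupport g hgt
        simp [he] at this⟩
    · obtain ⟨q, hqm, hq⟩ := hgc.isCompact.exists_isMaxOn hne continuous_snd.continuousOn
      have hqT := (hgs hqm).2.2
      refine ⟨(q.2 + T) / 2, by linarith, fun x t ht => ?_⟩
      by_contra hgt
      have : t ≤ q.2 := hq (subset_tsupport g hgt)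
      linarith
  obtain ⟨ψ, hψ, hw⟩ := exists_backward_solution c hT hg hτ h0
  have key := h.green ψ hψ
  rw [hxL, hxR, hz _ hdL, hz _ hdR, setIntegral_congr_fun (g := fun p => u p * g p) hU.measurableSet
    (fun p hp => by rw [hw p hp.2.1])] at key
  simp only [LinearMap.zero_apply, sub_zero, add_zero, mul_zero] at key
  rw [← key, ← integral_indicator hU.measurableSet]
  refine integral_congr_ae (Filter.Eventually.of_forall fun p => ?_)
  by_cases hp : p ∈ Ioo a b ×ˢ Ioo (0 : ℝ) T
  · simp only [indicator_of_mem hp, smul_eq_mul, mul_comm]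
  · have : g p = 0 := by
      by_contra hgt
      exact hp (hgs (subset_tsupport g hgt))
    simp only [indicator_of_notMem hp, this, zero_smul]

end Uniqueness

/-! ### One iteration at `θ = 1/4`. -/

section Contraction

open Classical in
/-- The weak time derivative divided by the wave speed; zero for a function that is not
integrable. -/
noncomputable def scaledDeriv (c T : ℝ) (v : ℝ → ℝ) : Flux T :=
  if hv : IntegrableOn v (Ioo 0 T) then c⁻¹ • weakDeriv v hv else 0

variable {c T : ℝ} {v w f g : ℝ → ℝ}

theorem scaledDeriv_eq (hv : IntegrableOn v (Ioo 0 T)) :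
    scaledDeriv c T v = c⁻¹ • weakDeriv v hv := dif_pos hv

theorem scaledDeriv_congr (hv : IntegrableOn v (Ioo 0 T))
    (h : v =ᵐ[volume.restrict (Ioo 0 T)] w) : scaledDeriv c T v = scaledDeriv c T w := by
  have hw : IntegrableOn w (Ioo 0 T) := Integrable.congr hv h
  rw [scaledDeriv_eq hv, scaledDeriv_eq hw, weakDeriv_congr hv hw h]

theorem scaledDeriv_of_ae_zero (h : v =ᵐ[volume.restrict (Ioo 0 T)] 0) :
    scaledDeriv c T v = 0 := by
  have hv : IntegrableOn v (Ioo 0 T) := (integrable_zero _ _ _).congr h.symm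
  rw [scaledDeriv_eq hv, weakDeriv_eq_zero hv h, smul_zero]

theorem scaledDeriv_mem : scaledDeriv c T v ∈ supportedFrom T 0 := by
  unfold scaledDeriv
  split_ifs with h
  · exact Submodule.smul_mem _ _ (weakDeriv_mem h)
  · exact zero_mem _

theorem ae_eq_zero_of_scaledDeriv (hc : 0 < c) (hv : IntegrableOn v (Ioo 0 T))
    (h : scaledDeriv c T v = 0) : v =ᵐ[volume.restrict (Ioo 0 T)] 0 := by
  rw [scaledDeriv_eq hv] at h
  refine ae_eq_zero_of_weakDeriv_eq_zero hv ?_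
  have := congrArg (fun p => c • p) h
  simpa [smul_smul, hc.ne'] using this

theorem scaledDeriv_update (hw : IntegrableOn w (Ioo 0 T)) (hf : IntegrableOn f (Ioo 0 T))
    (hg : IntegrableOn g (Ioo 0 T)) {θ : ℝ}
    (h : v =ᵐ[volume.restrict (Ioo 0 T)] fun t => w t - θ * (f t + g t)) :
    scaledDeriv c T v
      = scaledDeriv c T w - θ • (scaledDeriv c T f + scaledDeriv c T g) := by
  have hr : IntegrableOn (fun t => w t - θ * (f t + g t)) (Ioo 0 T) :=
    hw.sub ((hf.add hg).const_mul θ)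
  rw [← scaledDeriv_congr hr h.symm, scaledDeriv_eq hr, scaledDeriv_eq hw, scaledDeriv_eq hf,
    scaledDeriv_eq hg]
  have key : weakDeriv _ hr = weakDeriv w hw - θ • (weakDeriv f hf + weakDeriv g hg) := by
    ext η
    have iw := integrable_mul_deriv hw η.2.1
    have i_f := integrable_mul_deriv hf η.2.1
    have ig := integrable_mul_deriv hg η.2.1
    have is : IntegrableOn (fun t => θ * (f t * deriv η.1 t + g t * deriv η.1 t)) (Ioo 0 T) :=
      (i_f.add ig).const_mul θ
    simp only [weakDeriv_apply, LinearMap.sub_apply, LinearMap.smul_apply, LinearMap.add_apply,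
      smul_eq_mul]
    rw [← neg_add, ← integral_add i_f ig, mul_neg, ← integral_const_mul, sub_neg_eq_add,
      neg_add_eq_sub, ← neg_sub, ← integral_sub iw is]
    congr 1
    refine integral_congr_ae (Filter.Eventually.of_forall fun t => ?_)
    ring
  rw [key]
  module

/-- The delay by `d`, and no delay if `d` is negative. -/
noncomputable def delayPos (T d : ℝ) : Flux T →ₗ[ℝ] Flux T := delay T (max d 0) (le_max_right _ _)

theorem delayPos_mem {m d e : ℝ} (h : m ≤ d) {p : Flux T} (hp : p ∈ supportedFrom T e) :
    delayPos T d p ∈ supportedFrom T (e + m) :=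
  supportedFrom_anti (by linarith [le_max_left d 0]) (delay_mem _ hp)

theorem IsWeakSolution.transported_scaled {a b : ℝ} {u : ℝ × ℝ → ℝ} {tr : Traces T}
    (h : IsWeakSolution c a b T u tr) (hc : 0 < c) (hab : a < b) :
    Transported (delayPos T ((b - a) / c)) (scaledDeriv c T tr.dirL) (scaledDeriv c T tr.dirR)
      tr.dxL tr.dxR := by
  have hd : 0 ≤ (b - a) / c := div_nonneg (by linarith) hc.le
  rw [scaledDeriv_eq h.integrable_dirL, scaledDeriv_eq h.integrable_dirR, delayPos,
    delay_congr (max_eq_left hd) _ hd]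
  exact h.transported hc hab hd

variable {N : ℕ} {θ L : ℝ} {x : ℕ → ℝ} {w : ℕ → ℕ → ℝ → ℝ} {u φ : ℕ → ℕ → ℝ × ℝ → ℝ}
  {tu tφ : ℕ → ℕ → Traces T}

/-- Each `w k i` is the trace of the following Dirichlet solve, or zero at the right end, and
inherits integrability from there. -/
theorem IsRun.integrable_w (h : IsRun N c T θ x w u φ tu tφ) (k : ℕ) {i : ℕ} (hi : i ≤ N) :
    IntegrableOn (w k i) (Ioo 0 T) := by
  rcases hi.lt_or_eq with hi | rfl
  · exact Integrable.congr (h.u_wave k i hi).integrable_dirL (h.u_left k i hi)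
  · exact (integrable_zero _ _ _).congr (h.w_right k).symm

theorem IsRun.u_transported (h : IsRun N c T θ x w u φ tu tφ) (hc : 0 < c)
    (hx : IsPartition N L x) (k : ℕ) {i : ℕ} (hi : i < N) :
    Transported (delayPos T ((x (i + 1) - x i) / c)) (scaledDeriv c T (w k i))
      (scaledDeriv c T (w k (i + 1))) (tu (k + 1) i).dxL (tu (k + 1) i).dxR := by
  have hu := h.u_wave k i hi
  rw [← scaledDeriv_congr hu.integrable_dirL (h.u_left k i hi),
    ← scaledDeriv_congr hu.integrable_dirR (h.u_right k i hi)]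
  exact hu.transported_scaled hc (hx.lt i hi)

theorem IsRun.u_flux_mem (h : IsRun N c T θ x w u φ tu tφ) (hc : 0 < c) (hx : IsPartition N L x)
    {m d : ℝ} (hm : 0 < m) (hmx : ∀ i < N, m ≤ (x (i + 1) - x i) / c) (k : ℕ)
    (hW : ∀ j ≤ N, scaledDeriv c T (w k j) ∈ supportedFrom T d) {i : ℕ} (hi : i < N) :
    (tu (k + 1) i).dxL ∈ supportedFrom T d ∧ (tu (k + 1) i).dxR ∈ supportedFrom T d :=
  (h.u_transported hc hx k hi).flux_mem hm (fun _ _ hp => delayPos_mem (hmx i hi) hp)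
    (hW i hi.le) (hW (i + 1) hi) ((h.u_wave k i hi).dxL_mem hc (hx.lt i hi))
    ((h.u_wave k i hi).dxR_mem hc (hx.lt i hi))

/-- For `θ = 1/4` one iteration postpones the interface errors by twice the crossing time `m`. -/
theorem IsRun.step (h : IsRun N c T (1 / 4) x w u φ tu tφ) (hc : 0 < c)
    (hx : IsPartition N L x)
    {m d : ℝ} (hm : 0 < m) (hmx : ∀ i < N, m ≤ (x (i + 1) - x i) / c) (k : ℕ)
    (hW : ∀ j ≤ N, scaledDeriv c T (w k j) ∈ supportedFrom T d) :
    ∀ j ≤ N, scaledDeriv c T (w (k + 1) j) ∈ supportedFrom T (d + 2 * m) := by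
  let W : ℕ → Flux T := fun j => scaledDeriv c T (w k j)
  let S : ℕ → Flux T →ₗ[ℝ] Flux T := fun i => delayPos T ((x (i + 1) - x i) / c)
  have hS : ∀ i < N, ∀ e, ∀ p ∈ supportedFrom T e, S i p ∈ supportedFrom T (e + m) :=
    fun i hi _ _ hp => delayPos_mem (hmx i hi) hp
  have hSS : ∀ i < N, ∀ p ∈ supportedFrom T (d + m), S i p ∈ supportedFrom T (d + 2 * m) :=
    fun i hi p hp => (show d + m + m = d + 2 * m by ring) ▸ hS i hi _ p hp
  have hU : ∀ i < N, _ := fun i hi => h.u_flux_mem hc hx hm hmx k hW hi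
  have hUa := fun i (hi : i < N) => (h.u_transported hc hx k hi).flux_approx (hS i hi)
    (hW i hi.le) (hW (i + 1) hi) (hU i hi).1 (hU i hi).2
  -- The flux jumps, extended by zero to the physical boundary, so that the outer subdomains obey
  -- the same formulas as the interior ones.
  let R : ℕ → Flux T := fun j =>
    if 0 < j ∧ j < N then (tu (k + 1) (j - 1)).dxR - (tu (k + 1) j).dxL else 0
  have R0 : R 0 = 0 := if_neg (by omega)
  have RN : R N = 0 := if_neg (by omega)
  have R_succ : ∀ i, i + 1 < N → R (i + 1) = (tu (k + 1) i).dxR - (tu (k + 1) (i + 1)).dxL :=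
    fun i hi => if_pos ⟨by omega, hi⟩
  have R_mem : ∀ j, R j ∈ supportedFrom T d := fun j => by
    simp only [R]
    split_ifs with hj
    · exact sub_mem (hU _ (by omega)).2 (hU _ hj.2).1
    · exact zero_mem _
  have R_approx : ∀ i, i + 1 < N → R (i + 1) - ((2 : ℝ) • W (i + 1) - (2 : ℝ) • S i (W i)
      - (2 : ℝ) • S (i + 1) (W (i + 2))) ∈ supportedFrom T (d + 2 * m) := fun i hi => by
    have := sub_mem (hUa i (by omega)).2 (hUa (i + 1) hi).1
    rw [R_succ i hi]
    convert this using 1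
    module
  -- Under one more delay only the leading term `2 W j` of the jump survives. At the physical
  -- boundary both sides are zero.
  have SR_approx : ∀ l < N, ∀ j ≤ N, S l (R j) - (2 : ℝ) • S l (W j)
      ∈ supportedFrom T (d + 2 * m) := fun l hl j hj => by
    rw [← map_smul, ← map_sub]
    refine hSS l hl _ ?_
    by_cases hj' : 0 < j ∧ j < N
    · obtain ⟨i, rfl⟩ : ∃ i, j = i + 1 := ⟨j - 1, by omega⟩
      have e : R (i + 1) - (2 : ℝ) • W (i + 1) =
          (R (i + 1) - ((2 : ℝ) • W (i + 1) - (2 : ℝ) • S i (W i)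
            - (2 : ℝ) • S (i + 1) (W (i + 2))))
          - (2 : ℝ) • S i (W i) - (2 : ℝ) • S (i + 1) (W (i + 2)) := by module
      rw [e]
      exact sub_mem (sub_mem (supportedFrom_anti (by linarith) (R_approx i hj'.2))
        (Submodule.smul_mem _ _ (hS i (by omega) _ _ (hW i (by omega)))))
        (Submodule.smul_mem _ _ (hS (i + 1) hj'.2 _ _ (hW (i + 2) hj'.2)))
    · have hRj : R j = 0 := if_neg hj'
      have hWj : W j = 0 := by
        rcases (by omega : j = 0 ∨ j = N) with rfl | rfl
        · exact scaledDeriv_of_ae_zero (h.w_left k)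
        · exact scaledDeriv_of_ae_zero (h.w_right k)
      rw [hRj, hWj, smul_zero, sub_zero]
      exact zero_mem _
  have hΦ := fun i (hi : i < N) => (h.φ_wave k i hi).transported_scaled hc (hx.lt i hi)
  have dxR_eq : ∀ i, i + 1 < N → (tφ (k + 1) i).dxR = R (i + 1) := fun i hi =>
    (h.φ_right k i hi).trans (R_succ i hi).symm
  have dxL_eq : ∀ i, i + 1 < N → (tφ (k + 1) (i + 1)).dxL = -R (i + 1) := fun i hi => by
    rw [R_succ i hi, ← h.φ_left k i hi]
    abel
  have interior : ∀ i, i + 2 < N → _ := fun i hi =>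
    have hL : (tφ (k + 1) (i + 1)).dxL ∈ supportedFrom T d :=
      dxL_eq i (by omega) ▸ neg_mem (R_mem _)
    have hR : (tφ (k + 1) (i + 1)).dxR ∈ supportedFrom T d := dxR_eq (i + 1) hi ▸ R_mem _
    have hi' : i + 1 < N := by omega
    have hmem := (hΦ (i + 1) hi').dirichlet_mem hm (hS (i + 1) hi') scaledDeriv_mem
      scaledDeriv_mem hL hR
    (hΦ (i + 1) hi').dirichlet_approx (hS (i + 1) hi') hmem.1 hmem.2 hL hR
  -- In the first subdomain the left end carries a Dirichlet condition; the missing first-order term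
  -- agrees with `R 0 = 0`.
  have ΦR : ∀ i, i + 1 < N → scaledDeriv c T (tφ (k + 1) i).dirR
      - (R (i + 1) + (2 : ℝ) • S i (R i)) ∈ supportedFrom T (d + 2 * m) := fun i hi => by
    rcases i with _ | i
    · have h0 := hΦ 0 (by omega)
      rw [scaledDeriv_of_ae_zero (h.φ_first k)] at h0
      have := h0.mixed_left hm (hS 0 (by omega)) scaledDeriv_mem
        ((h.φ_wave k 0 (by omega)).dxL_mem hc (hx.lt 0 (by omega))) (dxR_eq 0 hi ▸ R_mem _)
      rw [dxR_eq 0 hi] at this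
      rwa [R0, map_zero, smul_zero, add_zero]
    · have := (interior i hi).2
      rw [dxR_eq (i + 1) hi, dxL_eq i (by omega)] at this
      convert this using 2
      rw [map_neg]
      module
  have ΦL : ∀ i, i + 1 < N → scaledDeriv c T (tφ (k + 1) (i + 1)).dirL
      - (R (i + 1) + (2 : ℝ) • S (i + 1) (R (i + 2))) ∈ supportedFrom T (d + 2 * m) :=
    fun i hi => by
    by_cases hi2 : i + 2 < N
    · have := (interior i hi2).1
      rw [dxR_eq (i + 1) hi2, dxL_eq i hi] at this
      convert this using 2
      module
    · have h0 := hΦ (i + 1) hi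
      rw [scaledDeriv_of_ae_zero (h.φ_last k (i + 1) (by omega))] at h0
      have := h0.mixed_right hm (hS (i + 1) hi) scaledDeriv_mem
        ((h.φ_wave k (i + 1) hi).dxR_mem hc (hx.lt (i + 1) hi))
        (dxL_eq i hi ▸ neg_mem (R_mem _))
      rw [dxL_eq i hi, ← sub_eq_add_neg] at this
      rwa [(by omega : i + 2 = N), RN, map_zero, smul_zero, add_zero]
  intro j hj
  by_cases hj' : 0 < j ∧ j < N
  · obtain ⟨i, rfl⟩ : ∃ i, j = i + 1 := ⟨j - 1, by omega⟩
    have hi := hj'.2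
    rw [scaledDeriv_update (h.integrable_w k hj) (h.φ_wave k i (by omega)).integrable_dirR
      (h.φ_wave k (i + 1) hi).integrable_dirL (h.update k i hi)]
    -- The weights are those for which `W`, `R` and all first-order terms cancel: 1/4 is `θ`, and
    -- 1/2 is `2 * θ`, the coefficient of `R` and of each `S R` in the update.
    have mem := sub_mem (sub_mem (sub_mem (sub_mem (neg_mem
      (Submodule.smul_mem _ (1 / 4 : ℝ) (ΦR i hi)))
      (Submodule.smul_mem _ (1 / 4 : ℝ) (ΦL i hi)))
      (Submodule.smul_mem _ (1 / 2 : ℝ) (R_approx i hi)))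
      (Submodule.smul_mem _ (1 / 2 : ℝ) (SR_approx i (by omega) i (by omega))))
      (Submodule.smul_mem _ (1 / 2 : ℝ) (SR_approx (i + 1) hi (i + 2) hi))
    convert mem using 1
    change W (i + 1) - _ = _
    module
  · rcases (by omega : j = 0 ∨ j = N) with rfl | rfl
    · rw [scaledDeriv_of_ae_zero (h.w_left _)]
      exact zero_mem _
    · rw [scaledDeriv_of_ae_zero (h.w_right _)]
      exact zero_mem _

theorem IsRun.interface_mem (h : IsRun N c T (1 / 4) x w u φ tu tφ) (hc : 0 < c)
    (hx : IsPartition N L x)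
    {m : ℝ} (hm : 0 < m) (hmx : ∀ i < N, m ≤ (x (i + 1) - x i) / c) (k : ℕ) :
    ∀ j ≤ N, scaledDeriv c T (w k j) ∈ supportedFrom T (2 * k * m) := by
  induction k with
  | zero => exact fun j _ => by simpa using scaledDeriv_mem
  | succ k ih =>
    have := h.step hc hx hm hmx k ih
    rwa [(by push_cast; ring : 2 * ((k + 1 : ℕ) : ℝ) * m = 2 * k * m + 2 * m)]

end Contraction

/-! ### Smallest width and conclusion. -/

theorem minWidth_le (N : ℕ) (x : ℕ → ℝ) {i : ℕ} (hi : i < N) : minWidth N x ≤ x (i + 1) - x i :=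
  ciInf_le (Set.finite_range _).bddBelow (⟨i, hi⟩ : Fin N)

theorem minWidth_pos {N : ℕ} (hN : 1 ≤ N) {L : ℝ} {x : ℕ → ℝ} (hx : IsPartition N L x) :
    0 < minWidth N x := by
  have : Nonempty (Fin N) := ⟨⟨0, hN⟩⟩
  obtain ⟨i, hi⟩ := exists_eq_ciInf_of_finite (f := fun i : Fin N => x ((i : ℕ) + 1) - x (i : ℕ))
  rw [minWidth, ← hi]
  linarith [hx.lt i i.2]

end NNWR

theorem theorem2p1 (N : ℕ) (hN : 1 ≤ N) (L c T : ℝ) (hc : 0 < c) (hT : 0 < T)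
    (x : ℕ → ℝ) (hx : NNWR.IsPartition N L x)
    (w : ℕ → ℕ → ℝ → ℝ) (u φ : ℕ → ℕ → ℝ × ℝ → ℝ) (tu tφ : ℕ → ℕ → NNWR.Traces T)
    (hrun : NNWR.IsRun N c T (1 / 4) x w u φ tu tφ)
    (k : ℕ) (hk : 1 ≤ k) (hTk : T / (k : ℝ) ≤ 2 * NNWR.minWidth N x / c) :
    (∀ i, 0 < i → i < N →
      w k i =ᵐ[volume.restrict (Ioc 0 T)] 0 ∧
      (ContinuousOn (w k i) (Ioc 0 T) → ∀ t ∈ Ioc 0 T, w k i t = 0)) ∧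
    (∀ i < N,
      u (k + 1) i =ᵐ[volume.restrict (Ioo (x i) (x (i + 1)) ×ˢ Ioc 0 T)] 0 ∧
      (ContinuousOn (u (k + 1) i) (Icc (x i) (x (i + 1)) ×ˢ Ioc 0 T) →
        ∀ p ∈ Icc (x i) (x (i + 1)) ×ˢ Ioc 0 T, u (k + 1) i p = 0)) := by
  have hm : 0 < NNWR.minWidth N x / c := div_pos (NNWR.minWidth_pos hN hx) hc
  have hmx : ∀ i < N, NNWR.minWidth N x / c ≤ (x (i + 1) - x i) / c := fun i hi =>
    div_le_div_of_nonneg_right (NNWR.minWidth_le N x hi) hc.le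
  have hkpos : (0 : ℝ) < k := by exact_mod_cast hk
  have hTm : T ≤ 2 * k * (NNWR.minWidth N x / c) := by
    have := (div_le_iff₀ hkpos).1 hTk
    calc T ≤ _ := this
      _ = _ := by ring
  have hW := hrun.interface_mem hc hx hm hmx k
  have hw : ∀ j ≤ N, w k j =ᵐ[volume.restrict (Ioo 0 T)] 0 := fun j hj =>
    NNWR.ae_eq_zero_of_scaledDeriv hc (hrun.integrable_w k hj)
      (NNWR.eq_zero_of_mem_supportedFrom hTm (hW j hj))
  refine ⟨fun i _ hi => ?_, fun i hi => ?_⟩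
  · have hae : w k i =ᵐ[volume.restrict (Ioc 0 T)] 0 := by
      rw [← Measure.restrict_congr_set Ioo_ae_eq_Ioc]
      exact hw i hi.le
    -- Equality almost everywhere becomes pointwise for continuous functions because the set lies in
    -- the closure of its interior; this also reaches `t = T`.
    refine ⟨hae, fun hcont => Measure.eqOn_of_ae_eq hae hcont continuousOn_const ?_⟩
    rw [interior_Ioc, closure_Ioo hT.ne]
    exact Ioc_subset_Icc_self
  · have hflux := hrun.u_flux_mem hc hx hm hmx k hW hi
    have hu0 := (hrun.u_wave k i hi).ae_eq_zero hT ((hrun.u_left k i hi).trans (hw i hi.le))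
      ((hrun.u_right k i hi).trans (hw (i + 1) hi))
      (NNWR.eq_zero_of_mem_supportedFrom hTm hflux.1)
      (NNWR.eq_zero_of_mem_supportedFrom hTm hflux.2)
    -- The lateral ends and the final time form a null set, so the open and the closed space
    -- intervals are handled together.
    have hset : ∀ {I : Set ℝ}, Ioo (x i) (x (i + 1)) =ᵐ[volume] I →
        u (k + 1) i =ᵐ[volume.restrict (I ×ˢ Ioc 0 T)] 0 := fun hI => by
      have e := Measure.set_prod_ae_eq hI (Ioo_ae_eq_Ioc (μ := volume) (a := (0 : ℝ)) (b := T))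
      rw [Measure.volume_eq_prod, ← Measure.restrict_congr_set e, ← Measure.volume_eq_prod]
      exact hu0
    refine ⟨hset Filter.EventuallyEq.rfl, fun hcont =>
      Measure.eqOn_of_ae_eq (hset Ioo_ae_eq_Icc) hcont continuousOn_const ?_⟩
    rw [interior_prod_eq, interior_Icc, interior_Ioc, closure_prod_eq, closure_Ioo hT.ne,
      closure_Ioo (hx.lt i hi).ne]
    exact prod_mono le_rfl Ioc_subset_Icc_self
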